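/- Let $K$ be a field of characteristic $0$, let $R=K[x_1,\dots,x_k]$ with the standard grading, and let $\Sigma=(\ell_1,\dots,\ell_n)$ be a finite collection of linear forms in $R$ (homogeneous polynomials of degree $1$; repetitions, proportional forms and the zero form are allowed). Let $1\le a\le n$ and let $$I_a(\Sigma)=\langle \ell_{i_1}\cdots\ell_{i_a} : 1\le i_1<\cdots<i_a\le n\rangle$$ be the ideal generated by all $a$-fold products of $\Sigma$. Let $\Gamma(\Sigma)$ be the set of prime ideals of $R$ generated by subsets of $\Sigma$ (the empty subset generates the zero ideal), and for $\mathfrak p\in\Gamma(\Sigma)$ let $\nu_\Sigma(\mathfrak p)=|\{i : \ell_i\in\mathfrak p\}|$. Then the following hold. 1. $I_a(\Sigma)$ has a linear graded free resolution: either $I_a(\Sigma)=0$, or there are an integer $b\ge 0$, integers $n_1,\dots,n_{b+1}\ge 1$ and an exact complex of graded $R$-modules with maps homogeneous of degree $0$ $$0\to R^{n_{b+1}}(-(a+b))\to\cdots\to R^{n_2}(-(a+1))\to R^{n_1}(-a)\to R\to R/I_a(\Sigma)\to 0,$$ where $R\to R/I_a(\Sigma)$ is the canonical projection. 2. $I_a(\Sigma)$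 has the (finite, not necessarily irredundant) primary decomposition $$I_a(\Sigma)=\bigcap_{\mathfrak p\in\Gamma(\Sigma)}\mathfrak p^{\,a-n+\nu_\Sigma(\mathfrak p)},$$ where a power with exponent $\le 0$ is read as $R$. That is, $\Gamma(\Sigma)$ is finite, the equality holds, and for each $\mathfrak p\in\Gamma(\Sigma)$ with $a-n+\nu_\Sigma(\mathfrak p)>0$ the ideal $\mathfrak p^{\,a-n+\nu_\Sigma(\mathfrak p)}$ is primary with radical $\mathfrak p$. -/

import Mathlib

namespace LinearForms

open MvPolynomial

/-- The ideal `I_a(Σ)` generated by all `a`-fold products `ℓ_{i_1} ⋯ ℓ_{i_a}`, `i_1 < ⋯ < i_a`,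
of a finite collection `Σ = (ℓ_1, …, ℓ_n)` of polynomials. -/
noncomputable def foldProductIdeal {K : Type*} [Field K] {k n : ℕ}
    (l : Fin n → MvPolynomial (Fin k) K) (a : ℕ) : Ideal (MvPolynomial (Fin k) K) :=
  Ideal.span {f | ∃ S : Finset (Fin n), S.card = a ∧ f = ∏ i ∈ S, l i}

/-- `Γ(Σ)`: the prime ideals that are generated by a subset of `Σ`. -/
def linearPrimes {K : Type*} [Field K] {k n : ℕ}
    (l : Fin n → MvPolynomial (Fin k) K) : Set (Ideal (MvPolynomial (Fin k) K)) :=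
  {p | p.IsPrime ∧ ∃ S : Set (Fin n), p = Ideal.span (l '' S)}

/-- `ν_Σ(p)`: the number of members of `Σ`, counted with multiplicity, that lie in `p`. -/
noncomputable def nu {K : Type*} [Field K] {k n : ℕ}
    (l : Fin n → MvPolynomial (Fin k) K) (p : Ideal (MvPolynomial (Fin k) K)) : ℕ :=
  {i : Fin n | l i ∈ p}.ncard

/-- The exponent `a - n + ν_Σ(p)`, replaced by `0` when it is negative. The truncated subtraction
of natural numbers is intended: a power with nonpositive exponent is read as the unit ideal. -/
noncomputable def exponent {K : Type*} [Field K] {k n : ℕ}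
    (l : Fin n → MvPolynomial (Fin k) K) (a : ℕ) (p : Ideal (MvPolynomial (Fin k) K)) : ℕ :=
  (a + nu l p) - n

/-- The component of degree `e` of the graded free module `R^r(-s)`, where
`R = K[x_1, …, x_k]` has the standard grading: it is `(R_{e-s})^r`, which is `0` for `e < s`. -/
noncomputable def gradedPiece (K : Type*) [Field K] (k r s e : ℕ) :
    Submodule K (Fin r → MvPolynomial (Fin k) K) :=
  Submodule.pi Set.univ
    (fun _ => if s ≤ e then homogeneousSubmodule (Fin k) K (e - s) else ⊥)

/-- A linear graded free resolution
`0 → R^{n_{b+1}}(-(d+b)) → ⋯ → R^{n_2}(-(d+1)) → R^{n_1}(-d) → R → R/I → 0`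
of `R/I`. Here `rank j = n_{j+1}`; the modules of index larger than `b` are zero. -/
structure LinearResolution {K : Type*} [Field K] {k : ℕ}
    (I : Ideal (MvPolynomial (Fin k) K)) (d : ℕ) where
  /-- the index of the last nonzero free module -/
  b : ℕ
  /-- the ranks of the free modules -/
  rank : ℕ → ℕ
  rank_pos : ∀ j, j ≤ b → 1 ≤ rank j
  rank_zero : ∀ j, b < j → rank j = 0
  /-- the map `R^{n_1}(-d) → R` -/
  aug : (Fin (rank 0) → MvPolynomial (Fin k) K) →ₗ[MvPolynomial (Fin k) K] MvPolynomial (Fin k) K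
  /-- the maps `R^{n_{j+2}}(-(d+j+1)) → R^{n_{j+1}}(-(d+j))` -/
  diff : ∀ j : ℕ, (Fin (rank (j + 1)) → MvPolynomial (Fin k) K) →ₗ[MvPolynomial (Fin k) K]
    (Fin (rank j) → MvPolynomial (Fin k) K)
  /-- all maps are homogeneous of degree zero -/
  aug_graded : ∀ e v, v ∈ gradedPiece K k (rank 0) d e → aug v ∈ homogeneousSubmodule (Fin k) K e
  diff_graded : ∀ j e v, v ∈ gradedPiece K k (rank (j + 1)) (d + (j + 1)) e →
    diff j v ∈ gradedPiece K k (rank j) (d + j) e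
  /-- exactness at `R`, at `R^{n_1}(-d)`, and further to the left -/
  exact_ring : Function.Exact aug (Submodule.mkQ I)
  exact_aug : Function.Exact (diff 0) aug
  exact_diff : ∀ j, Function.Exact (diff (j + 1)) (diff j)

/-- `I` has a linear graded free resolution with generators in degree `d`. By convention the zero
ideal has one. -/
def HasLinearResolution {K : Type*} [Field K] {k : ℕ}
    (I : Ideal (MvPolynomial (Fin k) K)) (d : ℕ) : Prop :=
  I = ⊥ ∨ Nonempty (LinearResolution I d)

end LinearForms

/-! Write `p_W` for the ideal generated by a space `W` of linear forms, and `I_a(s)` for the ideal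
of `a`-fold products from a subfamily `s`. Both assertions follow from one induction on `s`, made
possible by working modulo an arbitrary `p_W`. Its engine is the identity `I_{a+1}(s ∪ {i}) =
I_{a+1}(s) + ℓ_i I_a(s)`.

For the decomposition, the claim is that `I_a(s) + p_W` contains every `f` lying in `p_V ^ (a -
avoid) + p_W` for all `V ⊇ W`, where `avoid` counts the members of `s` outside `p_V`
(`mem_productIdeal_sup`). If `ℓ_i ∉ W`, induction modulo `W + ⟨ℓ_i⟩` writes `f = g + ℓ_i h`, with
`g` already in the target ideal. Dividing by `ℓ_i` in each `p_V ^ e + p_W` shows that `h` satisfies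
the hypothesis for `a` and `s`. The division is legitimate because a substitution into a polynomial
ring in `t` turns membership in `p_V ^ e + p_W` into divisibility by `t ^ e`, and `t` is prime
(`exists_splitHom`).

The same division yields `(I_{a+1}(s ∪ {i}) + p_W) : ℓ_i ⊆ I_a(s) + p_W`. Hence the image of
`I_{a+1}(s ∪ {i})` in `R/p_W` is an extension of the image of `I_{a+1}(s)` in `R/(p_W + ℓ_i)` by the
image of `I_a(s)` in `R/p_W`, shifted by one degree. Both ends are linearly resolved with generators
in degree `a + 1`, so the horseshoe lemma resolves the middle. Taking `W = 0` gives the theorem. -/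

namespace LinearForms

open MvPolynomial Polynomial

/-! ### Ideals generated by linear forms, and their powers -/

section Subspaces

variable {K σ : Type*} [Field K]

/-- The algebra map `x_i ↦ α x_i + t β x_i` into a polynomial ring in a new variable `t`. -/
noncomputable def splitHom (α β : MvPolynomial σ K →ₗ[K] MvPolynomial σ K) :
    MvPolynomial σ K →ₐ[K] (MvPolynomial σ K)[X] :=
  MvPolynomial.aeval fun i => Polynomial.C (α (MvPolynomial.X i)) +
    Polynomial.X * Polynomial.C (β (MvPolynomial.X i))

theorem splitHom_linear (α β : MvPolynomial σ K →ₗ[K] MvPolynomial σ K) {f : MvPolynomial σ K}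
    (hf : f ∈ homogeneousSubmodule σ K 1) :
    splitHom α β f = Polynomial.C (α f) + Polynomial.X * Polynomial.C (β f) := by
  rw [homogeneousSubmodule_one_eq_span_X] at hf
  induction hf using Submodule.span_induction with
  | mem x hx =>
    obtain ⟨i, rfl⟩ := hx
    simp [splitHom]
  | zero => simp
  | add x y _ _ hx hy =>
    rw [map_add, hx, hy]
    simp only [map_add]
    ring
  | smul c x _ hx =>
    rw [map_smul, hx]
    simp only [map_smul, smul_add, ← Polynomial.smul_C, mul_smul_comm]

/-- Membership in `p_V ^ e + p_W`, for subspaces `W ≤ V` of linear forms, is divisibility by `t ^ e`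
after a suitable substitution. -/
theorem exists_splitHom {W V : Submodule K (MvPolynomial σ K)} (hWV : W ≤ V)
    (hV : V ≤ homogeneousSubmodule σ K 1) :
    ∃ φ : MvPolynomial σ K →ₐ[K] (MvPolynomial σ K)[X],
      (∀ f ∈ homogeneousSubmodule σ K 1, Polynomial.X ∣ φ f → f ∈ V) ∧
      (∀ f ∈ V, f ∉ W → ∃ g : MvPolynomial σ K, g ≠ 0 ∧ φ f = Polynomial.X * Polynomial.C g) ∧
      ∀ e f, f ∈ Ideal.span (V : Set (MvPolynomial σ K)) ^ e ⊔
        Ideal.span (W : Set (MvPolynomial σ K)) ↔ Polynomial.X ^ e ∣ φ f := by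
  obtain ⟨P, hP⟩ := LinearMap.exists_leftInverse_of_injective V.subtype V.ker_subtype
  obtain ⟨Q, hQ⟩ := LinearMap.exists_leftInverse_of_injective W.subtype W.ker_subtype
  have hP' : ∀ v : V, P v = v := fun v => LinearMap.congr_fun hP v
  have hQ' : ∀ w : W, Q w = w := fun w => LinearMap.congr_fun hQ w
  -- On linear forms, `P` and `Q` are projections onto `V` and `W`. The substitution kills `W`,
  -- multiplies a complement of `W` in `V` by `t`, and fixes a complement of `V`.
  set α : MvPolynomial σ K →ₗ[K] MvPolynomial σ K := LinearMap.id - V.subtype ∘ₗ P with hα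
  set β : MvPolynomial σ K →ₗ[K] MvPolynomial σ K :=
    (LinearMap.id - W.subtype ∘ₗ Q) ∘ₗ V.subtype ∘ₗ P with hβ
  have αapp : ∀ f, α f = f - P f := fun f => by simp [hα]
  have βapp : ∀ f, β f = P f - Q (P f) := fun f => by simp [hβ]
  have αV : ∀ f ∈ V, α f = 0 := fun f hf => by
    rw [αapp, hP' ⟨f, hf⟩, sub_self]
  have βV : ∀ f ∈ V, β f = f - Q f := fun f hf => by
    rw [βapp, hP' ⟨f, hf⟩]
  have βW : ∀ f ∈ W, β f = 0 := fun f hf => by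
    rw [βV f (hWV hf), hQ' ⟨f, hf⟩, sub_self]
  have βmem : ∀ f, β f ∈ V := fun f => by
    rw [βapp]
    exact V.sub_mem (P f).2 (hWV (Q _).2)
  have φV : ∀ f ∈ V, splitHom α β f = Polynomial.X * Polynomial.C (β f) := fun f hf => by
    rw [splitHom_linear α β (hV hf), αV f hf, Polynomial.C_0, zero_add]
  refine ⟨splitHom α β, ?_, ?_, ?_⟩
  · intro f hf h
    rw [splitHom_linear α β hf, Polynomial.X_dvd_iff] at h
    have h0 : α f = 0 := by simpa using h
    rw [αapp, sub_eq_zero] at h0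
    rw [h0]
    exact (P f).2
  · intro f hf hfW
    refine ⟨β f, ?_, φV f hf⟩
    rw [βV f hf, Ne, sub_eq_zero]
    intro h
    exact hfW (h ▸ (Q f).2)
  · intro e f
    constructor
    · intro hf
      rw [← Ideal.mem_span_singleton]
      suffices h : Ideal.span (V : Set (MvPolynomial σ K)) ^ e ⊔
          Ideal.span (W : Set (MvPolynomial σ K)) ≤
          (Ideal.span {(Polynomial.X : (MvPolynomial σ K)[X]) ^ e}).comap (splitHom α β) from h hf
      refine sup_le ?_ ?_
      · rw [← Ideal.span_singleton_pow]
        refine le_trans (Ideal.pow_right_mono ?_ e) (Ideal.le_comap_pow _ e)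
        rw [Ideal.span_le]
        intro v hv
        rw [SetLike.mem_coe, Ideal.mem_comap, Ideal.mem_span_singleton]
        exact Dvd.intro _ (φV v hv).symm
      · rw [Ideal.span_le]
        intro w hw
        rw [SetLike.mem_coe, Ideal.mem_comap]
        have : splitHom α β w = 0 := by rw [φV w (hWV hw), βW w hw, Polynomial.C_0, mul_zero]
        change splitHom α β w ∈ _
        rw [this]
        exact Ideal.zero_mem _
    · intro hf
      set p := Ideal.span (V : Set (MvPolynomial σ K)) with hp
      -- The coefficient of `t ^ i` in the image lies in `p ^ i`, while setting `t = 1` recovers `f`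
      -- modulo `p_W`. If only powers `t ^ i` with `i ≥ e` occur, then `f ∈ p ^ e + p_W`.
      have rees : ∀ g, splitHom α β g ∈ reesAlgebra p := by
        intro g
        induction g using MvPolynomial.induction_on with
        | C a =>
          rw [← MvPolynomial.algebraMap_eq, AlgHom.commutes]
          exact (reesAlgebra p).algebraMap_mem (algebraMap K _ a)
        | add g h hg hh => rw [map_add]; exact add_mem hg hh
        | mul_X g i hg =>
          rw [map_mul]
          refine mul_mem hg ?_
          rw [splitHom, MvPolynomial.aeval_X]
          refine add_mem ((reesAlgebra p).algebraMap_mem (α (MvPolynomial.X i))) ?_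
          rw [mul_comm, Polynomial.C_mul_X_eq_monomial]
          exact reesAlgebra.monomial_mem.mpr
            (by simpa using (Ideal.subset_span (βmem _) : β (MvPolynomial.X i) ∈ p))
      have spec : ∀ g, g - (splitHom α β g).eval 1 ∈ Ideal.span (W : Set (MvPolynomial σ K)) := by
        intro g
        rw [← Ideal.Quotient.mk_eq_mk_iff_sub_mem]
        let ψ : MvPolynomial σ K →ₐ[K] MvPolynomial σ K ⧸ Ideal.span (W : Set (MvPolynomial σ K)) :=
          (Ideal.Quotient.mkₐ K _).comp
            (((Polynomial.aeval (1 : MvPolynomial σ K)).restrictScalars K).comp (splitHom α β))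
        have : Ideal.Quotient.mkₐ K (Ideal.span (W : Set (MvPolynomial σ K))) = ψ := by
          refine MvPolynomial.algHom_ext fun i => ?_
          simp only [ψ, AlgHom.comp_apply, AlgHom.restrictScalars_apply, splitHom,
            MvPolynomial.aeval_X, Polynomial.coe_aeval_eq_eval, Polynomial.eval_add,
            Polynomial.eval_mul, Polynomial.eval_C, Polynomial.eval_X, one_mul, αapp, βapp]
          rw [Ideal.Quotient.mkₐ_eq_mk, Ideal.Quotient.mk_eq_mk_iff_sub_mem]
          rw [sub_add_sub_cancel, sub_sub_cancel]
          exact Ideal.subset_span (Q _).2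
        exact DFunLike.congr_fun this g
      have hsum : (splitHom α β f).eval 1 ∈ p ^ e := by
        rw [Polynomial.eval_eq_sum]
        refine Ideal.sum_mem _ fun i hi => ?_
        simp only [one_pow, mul_one]
        have hie : e ≤ i := by
          by_contra! hlt
          exact Polynomial.mem_support_iff.mp hi (Polynomial.X_pow_dvd_iff.mp hf i hlt)
        exact Ideal.pow_le_pow_right hie ((mem_reesAlgebra_iff p _).mp (rees f) i)
      have := add_mem (Ideal.mem_sup_left hsum : _ ∈ p ^ e ⊔ _) (Ideal.mem_sup_right (spec f))
      simpa using this

variable {W V : Submodule K (MvPolynomial σ K)}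

theorem mem_of_mem_span (hV : V ≤ homogeneousSubmodule σ K 1) {f : MvPolynomial σ K}
    (hf : f ∈ homogeneousSubmodule σ K 1)
    (h : f ∈ Ideal.span (V : Set (MvPolynomial σ K))) : f ∈ V := by
  obtain ⟨φ, h1, -, h3⟩ := exists_splitHom (le_refl V) hV
  refine h1 f hf ?_
  have := (h3 1 f).mp (by simpa using h)
  simpa using this

/-- The image of `g` is not divisible by the prime `t`, so every factor `t` of the product comes
from `f`. -/
theorem mem_pow_sup_of_mul_mem_of_notMem (hWV : W ≤ V) (hV : V ≤ homogeneousSubmodule σ K 1)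
    {g f : MvPolynomial σ K} (hg : g ∉ Ideal.span (V : Set (MvPolynomial σ K))) {e : ℕ}
    (h : g * f ∈ Ideal.span (V : Set (MvPolynomial σ K)) ^ e ⊔
      Ideal.span (W : Set (MvPolynomial σ K))) :
    f ∈ Ideal.span (V : Set (MvPolynomial σ K)) ^ e ⊔
      Ideal.span (W : Set (MvPolynomial σ K)) := by
  obtain ⟨φ, -, -, h3⟩ := exists_splitHom hWV hV
  rw [h3] at h ⊢
  rw [map_mul] at h
  refine Polynomial.prime_X.pow_dvd_of_dvd_mul_left e (fun hd => hg ?_) h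
  have := (h3 1 g).mpr (by simpa using hd)
  rwa [pow_one, sup_of_le_left (Ideal.span_mono hWV)] at this

/-- The image of `g` is `t` times a nonzero constant in `t`, so it absorbs exactly one factor `t`.
-/
theorem mem_pow_sup_of_linear_mul_mem (hWV : W ≤ V) (hV : V ≤ homogeneousSubmodule σ K 1)
    {g f : MvPolynomial σ K} (hgV : g ∈ V) (hgW : g ∉ W) {e : ℕ}
    (h : g * f ∈ Ideal.span (V : Set (MvPolynomial σ K)) ^ (e + 1) ⊔
      Ideal.span (W : Set (MvPolynomial σ K))) :
    f ∈ Ideal.span (V : Set (MvPolynomial σ K)) ^ e ⊔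
      Ideal.span (W : Set (MvPolynomial σ K)) := by
  obtain ⟨φ, -, h2, h3⟩ := exists_splitHom hWV hV
  obtain ⟨c, hc, hφ⟩ := h2 g hgV hgW
  rw [h3] at h ⊢
  rw [map_mul, hφ, pow_succ', mul_assoc, mul_dvd_mul_iff_left Polynomial.X_ne_zero] at h
  refine Polynomial.prime_X.pow_dvd_of_dvd_mul_left e (fun hd => hc ?_) h
  simpa [Polynomial.X_dvd_iff] using hd

/-- With `W = V` and `e = 1`, the ideal is the preimage of the prime `(t)`. -/
theorem span_isPrime (hV : V ≤ homogeneousSubmodule σ K 1) :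
    (Ideal.span (V : Set (MvPolynomial σ K))).IsPrime := by
  obtain ⟨φ, -, -, h3⟩ := exists_splitHom (le_refl V) hV
  have h : Ideal.span (V : Set (MvPolynomial σ K)) =
      (Ideal.span {(Polynomial.X : (MvPolynomial σ K)[X])}).comap φ := by
    ext f
    have := h3 1 f
    rw [pow_one, pow_one, sup_idem] at this
    rw [this, Ideal.mem_comap, Ideal.mem_span_singleton]
  rw [h]
  have : (Ideal.span {(Polynomial.X : (MvPolynomial σ K)[X])}).IsPrime :=
    (Ideal.span_singleton_prime Polynomial.X_ne_zero).mpr Polynomial.prime_X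
  exact Ideal.comap_isPrime _ _

theorem span_pow_isPrimary (hV : V ≤ homogeneousSubmodule σ K 1) {e : ℕ} (he : 0 < e) :
    (Ideal.span (V : Set (MvPolynomial σ K)) ^ e).IsPrimary := by
  have hprime := span_isPrime hV
  rw [Ideal.isPrimary_iff]
  refine ⟨fun h => hprime.ne_top (eq_top_iff.mpr (h ▸ Ideal.pow_le_self he.ne')), ?_⟩
  intro x y hxy
  rw [Ideal.radical_pow _ he.ne', hprime.radical]
  by_contra! hcon
  refine hcon.1 ?_
  have := mem_pow_sup_of_mul_mem_of_notMem (W := ⊥) bot_le hV hcon.2 (e := e)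
    (f := x) (Ideal.mem_sup_left (by rwa [mul_comm]))
  simpa using this

end Subspaces

/-! ### The intersection formula and the colon ideals -/

section Decomposition

variable {ι : Type*}

/-- The ideal generated by the `a`-fold products of the family `l` restricted to `s`. -/
noncomputable def productIdeal {A : Type*} [CommRing A] (l : ι → A) (a : ℕ) (s : Finset ι) :
    Ideal A :=
  Ideal.span ((fun S => ∏ i ∈ S, l i) '' (s.powersetCard a : Set (Finset ι)))

open scoped Classical in
/-- The number of members of the family `l` restricted to `s` that avoid `p`. -/
noncomputable def avoid {A : Type*} [CommRing A] (l : ι → A) (p : Ideal A) (s : Finset ι) : ℕ :=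
  (s.filter fun i => l i ∉ p).card

variable {A : Type*} [CommRing A] (l : ι → A)

theorem mem_sup_of_le {I J L : Ideal A} (hIJ : I ≤ J) {x : A} (hx : x ∈ I ⊔ L) : x ∈ J ⊔ L :=
  sup_le_sup_right hIJ L hx

theorem productIdeal_zero (s : Finset ι) : productIdeal l 0 s = ⊤ := by
  simp [productIdeal]

theorem productIdeal_succ_empty (a : ℕ) : productIdeal l (a + 1) ∅ = ⊥ := by
  simp [productIdeal]

theorem productIdeal_succ_insert [DecidableEq ι] (a : ℕ) {s : Finset ι} {i : ι} (hi : i ∉ s) :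
    productIdeal l (a + 1) (insert i s) =
      productIdeal l (a + 1) s ⊔ Ideal.span {l i} * productIdeal l a s := by
  rw [productIdeal, Finset.powersetCard_succ_insert hi, Finset.coe_union, Set.image_union,
    Ideal.span_union, productIdeal, productIdeal, Ideal.span_mul_span', Set.singleton_mul,
    Finset.coe_image, Set.image_image, Set.image_image]
  congr 2
  refine Set.image_congr fun S hS => ?_
  have : i ∉ S := fun h => hi ((Finset.mem_powersetCard.mp hS).1 h)
  rw [Finset.prod_insert this]

theorem avoid_insert_of_mem [DecidableEq ι] {p : Ideal A} (s : Finset ι) {i : ι} (h : l i ∈ p) :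
    avoid l p (insert i s) = avoid l p s := by
  simp [avoid, Finset.filter_insert, h]

theorem avoid_insert_of_notMem [DecidableEq ι] {p : Ideal A} {s : Finset ι} {i : ι} (hi : i ∉ s)
    (h : l i ∉ p) : avoid l p (insert i s) = avoid l p s + 1 := by
  simp [avoid, Finset.filter_insert, h, hi]

theorem avoid_le_avoid {p q : Ideal A} {s : Finset ι} (h : ∀ i ∈ s, l i ∈ q → l i ∈ p) :
    avoid l p s ≤ avoid l q s := by
  classical
  refine Finset.card_le_card fun i hi => ?_
  rw [Finset.mem_filter] at hi ⊢
  exact ⟨hi.1, fun hq => hi.2 (h i hi.1 hq)⟩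

/-- At most `avoid l p s` factors of a product lie outside `p`; the others supply the power. -/
theorem productIdeal_le_pow (p : Ideal A) (a : ℕ) (s : Finset ι) :
    productIdeal l a s ≤ p ^ (a - avoid l p s) := by
  classical
  rw [productIdeal, Ideal.span_le]
  rintro _ ⟨S, hS, rfl⟩
  obtain ⟨hSs, rfl⟩ := Finset.mem_powersetCard.mp hS
  change ∏ i ∈ S, l i ∈ _
  rw [← Finset.prod_filter_mul_prod_filter_not S (fun i => l i ∈ p)]
  refine Ideal.mul_mem_right _ _ (Ideal.pow_le_pow_right (n := (S.filter fun i => l i ∈ p).card) ?_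
    ?_)
  · have h1 := Finset.card_filter_add_card_filter_not (s := S) (fun i => l i ∈ p)
    have h2 : (S.filter fun i => l i ∉ p).card ≤ avoid l p s :=
      Finset.card_le_card (Finset.filter_subset_filter _ hSs)
    omega
  · rw [← Finset.prod_const]
    exact Ideal.prod_mem_prod fun i hi => (Finset.mem_filter.mp hi).2

variable {K σ : Type*} [Field K] {l : ι → MvPolynomial σ K}

/-- If `ℓ_i ∈ p_V`, removing it lowers the exponent by one, as does dividing by a form in `V`
outside `W`. If not, `a` and `avoid` both drop by one, the exponent is unchanged, and `ℓ_i` simply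
cancels. -/
theorem mem_pow_avoid_of_mul_mem [DecidableEq ι] {W V : Submodule K (MvPolynomial σ K)}
    (hWV : W ≤ V) (hV : V ≤ homogeneousSubmodule σ K 1) {s : Finset ι} {i : ι}
    (hl : l i ∈ homogeneousSubmodule σ K 1) (hi : i ∉ s) (hiW : l i ∉ W) {a : ℕ}
    {h : MvPolynomial σ K}
    (hh : l i * h ∈ Ideal.span (V : Set (MvPolynomial σ K)) ^
      (a + 1 - avoid l (Ideal.span (V : Set (MvPolynomial σ K))) (insert i s)) ⊔
        Ideal.span (W : Set (MvPolynomial σ K))) :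
    h ∈ Ideal.span (V : Set (MvPolynomial σ K)) ^
      (a - avoid l (Ideal.span (V : Set (MvPolynomial σ K))) s) ⊔
        Ideal.span (W : Set (MvPolynomial σ K)) := by
  by_cases hiV : l i ∈ Ideal.span (V : Set (MvPolynomial σ K))
  · rw [avoid_insert_of_mem l s hiV] at hh
    by_cases hle : avoid l (Ideal.span (V : Set (MvPolynomial σ K))) s ≤ a
    · rw [Nat.sub_add_comm hle] at hh
      exact mem_pow_sup_of_linear_mul_mem hWV hV (mem_of_mem_span hV hl hiV) hiW hh
    -- Here the truncated exponent is `0`, so the power is the whole ring.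
    · rw [Nat.sub_eq_zero_of_le (not_le.mp hle).le]
      simp
  · rw [avoid_insert_of_notMem l hi hiV, Nat.add_sub_add_right] at hh
    exact mem_pow_sup_of_mul_mem_of_notMem hWV hV hiV hh

theorem span_sup_singleton (W : Submodule K (MvPolynomial σ K)) (x : MvPolynomial σ K) :
    Ideal.span ((W ⊔ Submodule.span K {x} : Submodule K (MvPolynomial σ K)) :
      Set (MvPolynomial σ K)) = Ideal.span (W : Set (MvPolynomial σ K)) ⊔ Ideal.span {x} := by
  apply le_antisymm
  · rw [Ideal.span_le]
    intro f hf
    obtain ⟨w, hw, z, hz, rfl⟩ := Submodule.mem_sup.mp hf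
    obtain ⟨c, rfl⟩ := Submodule.mem_span_singleton.mp hz
    refine add_mem (Ideal.mem_sup_left (Ideal.subset_span hw)) (Ideal.mem_sup_right ?_)
    rw [MvPolynomial.smul_eq_C_mul]
    exact Ideal.mul_mem_left _ _ (Ideal.mem_span_singleton_self x)
  · refine sup_le (Ideal.span_mono (SetLike.coe_subset_coe.mpr le_sup_left)) ?_
    rw [Ideal.span_singleton_le_iff_mem]
    exact Ideal.subset_span (Submodule.mem_sup_right (Submodule.mem_span_singleton_self x))

/-- The auxiliary `W` is what lets the induction run: the step enlarges it by `ℓ_i`. A zero form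
causes no trouble, since it lies in every `W`. -/
theorem mem_productIdeal_sup (hl : ∀ i, l i ∈ homogeneousSubmodule σ K 1) (s : Finset ι) :
    ∀ (a : ℕ) (W : Submodule K (MvPolynomial σ K)), W ≤ homogeneousSubmodule σ K 1 →
      ∀ f : MvPolynomial σ K, (∀ V, W ≤ V → V ≤ homogeneousSubmodule σ K 1 →
        f ∈ Ideal.span (V : Set (MvPolynomial σ K)) ^
          (a - avoid l (Ideal.span (V : Set (MvPolynomial σ K))) s) ⊔
            Ideal.span (W : Set (MvPolynomial σ K))) →
      f ∈ productIdeal l a s ⊔ Ideal.span (W : Set (MvPolynomial σ K)) := by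
  classical
  induction s using Finset.induction_on with
  | empty =>
    intro a W hW f hf
    rcases a with _ | a
    · simp [productIdeal_zero]
    -- The choice `V = W` suffices: the exponent is positive, so the hypothesis reduces to `f ∈
    -- p_W`.
    · have h := hf W le_rfl hW
      rw [productIdeal_succ_empty, bot_sup_eq]
      rwa [sup_of_le_right] at h
      exact Ideal.pow_le_self (by simp [avoid])
  | insert i s hi ih =>
    intro a W hW f hf
    rcases a with _ | a
    · simp [productIdeal_zero]
    rw [productIdeal_succ_insert l a hi]
    by_cases hiW : l i ∈ W
    · refine mem_sup_of_le le_sup_left (ih (a + 1) W hW f fun V hWV hV => ?_)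
      have h := hf V hWV hV
      rwa [avoid_insert_of_mem l s (Ideal.subset_span (hWV hiW))] at h
    have hW' : W ⊔ Submodule.span K {l i} ≤ homogeneousSubmodule σ K 1 :=
      sup_le hW ((Submodule.span_singleton_le_iff_mem _ _).mpr (hl i))
    have h1 := ih (a + 1) _ hW' f fun V hWV hV => by
      have h := hf V (le_sup_left.trans hWV) hV
      rw [avoid_insert_of_mem l s (Ideal.subset_span
        (hWV (Submodule.mem_sup_right (Submodule.mem_span_singleton_self _))))] at h
      exact sup_le_sup_left (α := Ideal (MvPolynomial σ K))
        (Ideal.span_mono (SetLike.coe_subset_coe.mpr le_sup_left)) _ h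
    rw [span_sup_singleton, ← sup_assoc] at h1
    obtain ⟨g, hg, y, hy, rfl⟩ := Submodule.mem_sup.mp h1
    obtain ⟨h, rfl⟩ := Ideal.mem_span_singleton'.mp hy
    have hg' : g ∈ productIdeal l (a + 1) (insert i s) ⊔
        Ideal.span (W : Set (MvPolynomial σ K)) := by
      rw [productIdeal_succ_insert l a hi]
      exact mem_sup_of_le le_sup_left hg
    -- The summand `g` lies in every `p_V ^ (a + 1 - avoid) + p_W`, hence so does `ℓ_i h`, which can
    -- then be divided by `ℓ_i`.
    have hh : h ∈ productIdeal l a s ⊔ Ideal.span (W : Set (MvPolynomial σ K)) := by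
      refine ih a W hW h fun V hWV hV => mem_pow_avoid_of_mul_mem hWV hV (hl i) hi hiW ?_
      have h2 := sub_mem (hf V hWV hV)
        (mem_sup_of_le (productIdeal_le_pow l _ _ _) hg')
      rwa [add_sub_cancel_left, mul_comm] at h2
    refine add_mem (mem_sup_of_le le_sup_left hg) ?_
    obtain ⟨u, hu, w, hw, rfl⟩ := Submodule.mem_sup.mp hh
    rw [add_mul, mul_comm u]
    exact add_mem (Ideal.mem_sup_left (Ideal.mem_sup_right
      (Ideal.mul_mem_mul (Ideal.mem_span_singleton_self _) hu)))
      (Ideal.mem_sup_right (Ideal.mul_mem_right _ _ hw))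

/-- This colon computation gives exactness in the middle of the sequence used for resolutions. -/
theorem mem_productIdeal_sup_of_mul_mem [DecidableEq ι]
    (hl : ∀ i, l i ∈ homogeneousSubmodule σ K 1) {s : Finset ι} {i : ι} (hi : i ∉ s) {a : ℕ}
    {W : Submodule K (MvPolynomial σ K)} (hW : W ≤ homogeneousSubmodule σ K 1) (hiW : l i ∉ W)
    {h : MvPolynomial σ K} (hh : l i * h ∈ productIdeal l (a + 1) (insert i s) ⊔
      Ideal.span (W : Set (MvPolynomial σ K))) :
    h ∈ productIdeal l a s ⊔ Ideal.span (W : Set (MvPolynomial σ K)) :=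
  mem_productIdeal_sup hl s a W hW h fun _ hWV hV =>
    mem_pow_avoid_of_mul_mem hWV hV (hl i) hi hiW
      (mem_sup_of_le (productIdeal_le_pow l _ _ _) hh)

end Decomposition

end LinearForms

namespace LinearForms

universe u

/-! ### Linear resolutions of graded modules -/

section Resolutions

variable {R : Type u} [CommRing R] (𝒢 : ℕ → AddSubgroup R)

/-- The component of degree `e` of `R(-d)`. -/
def twist (d e : ℕ) : AddSubgroup R := if d ≤ e then 𝒢 (e - d) else ⊥

/-- The component of degree `e` of the graded free module `R(-d)^ι`. -/
def freePiece (ι : Type) (d e : ℕ) : AddSubgroup (ι → R) :=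
  AddSubgroup.pi Set.univ fun _ => twist 𝒢 d e

/-- A finite linear resolution of length at most `b`, with generators in degree `d`, of a module
with specified graded pieces. -/
def LinearlyResolved : ℕ → ℕ → ∀ (M : Type u) [AddCommGroup M] [Module R M],
    (ℕ → AddSubgroup M) → Prop
  | 0, _, M, _, _, _ => Subsingleton M
  | b + 1, d, M, _, _, 𝒜 => ∃ (ι : Type) (_ : Fintype ι) (π : (ι → R) →ₗ[R] M),
      Function.Surjective π ∧ (∀ e, 𝒜 e = (freePiece 𝒢 ι d e).map π.toAddMonoidHom) ∧
      LinearlyResolved b (d + 1) (LinearMap.ker π)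
        (fun e => (freePiece 𝒢 ι d e).comap (LinearMap.ker π).subtype.toAddMonoidHom)

variable {𝒢}

theorem mem_freePiece {ι : Type} {d e : ℕ} {v : ι → R} :
    v ∈ freePiece 𝒢 ι d e ↔ ∀ i, v i ∈ twist 𝒢 d e := by
  simp [freePiece, AddSubgroup.mem_pi]

theorem twist_succ_succ (d e : ℕ) : twist 𝒢 (d + 1) (e + 1) = twist 𝒢 d e := by
  simp [twist]

theorem twist_succ_zero (d : ℕ) : twist 𝒢 (d + 1) 0 = ⊥ := by
  simp [twist]

theorem freePiece_succ_succ (ι : Type) (d e : ℕ) :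
    freePiece 𝒢 ι (d + 1) (e + 1) = freePiece 𝒢 ι d e := by
  simp [freePiece, twist_succ_succ]

theorem freePiece_succ_zero (ι : Type) (d : ℕ) : freePiece 𝒢 ι (d + 1) 0 = ⊥ := by
  ext v
  simp [mem_freePiece, twist_succ_zero, funext_iff]

/-- The homogeneous elements of the ring act compatibly with the graded pieces. -/
def GradedAction (𝒢 : ℕ → AddSubgroup R) {M : Type*} [AddCommGroup M] [Module R M]
    (ℬ : ℕ → AddSubgroup M) : Prop :=
  ∀ i e r m, r ∈ 𝒢 i → m ∈ ℬ e → r • m ∈ ℬ (i + e)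

theorem gradedAction_freePiece [SetLike.GradedMonoid 𝒢] (ι : Type) (d : ℕ) :
    GradedAction 𝒢 (freePiece 𝒢 ι d) := by
  intro i e r v hr hv
  rw [mem_freePiece] at hv ⊢
  intro j
  have h := hv j
  by_cases hde : d ≤ e
  · rw [twist, if_pos hde] at h
    rw [twist, if_pos (by omega), Nat.add_sub_assoc hde]
    exact SetLike.mul_mem_graded hr h
  · rw [twist, if_neg hde, AddSubgroup.mem_bot] at h
    rw [Pi.smul_apply, h, smul_zero]
    exact zero_mem _

theorem GradedAction.comap {M N : Type*} [AddCommGroup M] [Module R M] [AddCommGroup N]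
    [Module R N] {ℬ : ℕ → AddSubgroup M} (h : GradedAction 𝒢 ℬ) (f : N →ₗ[R] M) :
    GradedAction 𝒢 (fun e => (ℬ e).comap f.toAddMonoidHom) := by
  intro i e r m hr hm
  have := h i e r (f m) hr hm
  rw [← map_smul] at this
  exact this

variable {A B C : Type u} [AddCommGroup A] [Module R A] [AddCommGroup B] [Module R B]
  [AddCommGroup C] [Module R C]

/-- A short exact sequence that is exact on all graded pieces. -/
structure GradedShortExact (𝒜 : ℕ → AddSubgroup A) (ℬ : ℕ → AddSubgroup B)
    (𝒞 : ℕ → AddSubgroup C) (f : A →ₗ[R] B) (g : B →ₗ[R] C) : Prop where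
  inj : Function.Injective f
  surj : Function.Surjective g
  exact : Function.Exact f g
  mem_iff : ∀ e x, x ∈ 𝒜 e ↔ f x ∈ ℬ e
  map_mem : ∀ e, ∀ y ∈ ℬ e, g y ∈ 𝒞 e
  lift : ∀ e, ∀ z ∈ 𝒞 e, ∃ y ∈ ℬ e, g y = z

theorem LinearlyResolved.of_subsingleton (b : ℕ) : ∀ (d : ℕ) (M : Type u) [AddCommGroup M]
    [Module R M] [Subsingleton M] (𝒜 : ℕ → AddSubgroup M), LinearlyResolved 𝒢 b d M 𝒜 := by
  induction b with
  | zero => intro d M _ _ h 𝒜; exact h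
  | succ b ih =>
    intro d M _ _ h 𝒜
    exact ⟨Empty, inferInstance, 0, fun x => ⟨0, Subsingleton.elim _ _⟩,
      fun e => Subsingleton.elim _ _, ih _ _ _⟩

theorem LinearlyResolved.succ (b : ℕ) : ∀ (d : ℕ) (M : Type u) [AddCommGroup M] [Module R M]
    (𝒜 : ℕ → AddSubgroup M), LinearlyResolved 𝒢 b d M 𝒜 → LinearlyResolved 𝒢 (b + 1) d M 𝒜 := by
  induction b with
  | zero =>
    intro d M _ _ 𝒜 h
    have : Subsingleton M := h
    exact of_subsingleton 1 d M 𝒜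
  | succ b ih =>
    rintro d M _ _ 𝒜 ⟨ι, hι, π, h1, h2, h3⟩
    exact ⟨ι, hι, π, h1, h2, ih _ _ _ h3⟩

theorem LinearlyResolved.mono {b b' d : ℕ} (hb : b ≤ b') {𝒜 : ℕ → AddSubgroup A}
    (h : LinearlyResolved 𝒢 b d A 𝒜) : LinearlyResolved 𝒢 b' d A 𝒜 := by
  induction hb with
  | refl => exact h
  | step _ ih => exact ih.succ

/-- Homogeneous generators of degree `d`, the images of the unit vectors. -/
theorem single_mem_freePiece [SetLike.GradedMonoid 𝒢] {ι : Type} [DecidableEq ι] (d : ℕ) (i : ι) :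
    (Pi.single i 1 : ι → R) ∈ freePiece 𝒢 ι d d := by
  rw [mem_freePiece]
  intro j
  rw [twist, if_pos le_rfl, Nat.sub_self, Pi.single_apply]
  split_ifs
  · exact SetLike.GradedOne.one_mem
  · exact zero_mem _

/-- The horseshoe lemma for linear resolutions. -/
theorem LinearlyResolved.extension [SetLike.GradedMonoid 𝒢] (b : ℕ) :
    ∀ (d : ℕ) {A B C : Type u} [AddCommGroup A] [Module R A] [AddCommGroup B] [Module R B]
      [AddCommGroup C] [Module R C] {𝒜 : ℕ → AddSubgroup A} {ℬ : ℕ → AddSubgroup B}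
      {𝒞 : ℕ → AddSubgroup C} {f : A →ₗ[R] B} {g : B →ₗ[R] C},
      GradedShortExact 𝒜 ℬ 𝒞 f g → GradedAction 𝒢 ℬ → LinearlyResolved 𝒢 b d A 𝒜 →
      LinearlyResolved 𝒢 b d C 𝒞 → LinearlyResolved 𝒢 b d B ℬ := by
  classical
  induction b with
  | zero =>
    intro d A B C _ _ _ _ _ _ 𝒜 ℬ 𝒞 f g H _ hA hC
    have hA' : Subsingleton A := hA
    have hC' : Subsingleton C := hC
    refine subsingleton_of_forall_eq 0 fun y => ?_
    obtain ⟨x, rfl⟩ := (H.exact y).mp (Subsingleton.elim _ _)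
    rw [Subsingleton.elim x 0, map_zero]
  | succ b ih =>
    rintro d A B C _ _ _ _ _ _ 𝒜 ℬ 𝒞 f g H hℬ ⟨ι, _, π, hπ, h𝒜, hA⟩ ⟨κ, _, ρ, hρ, h𝒞, hC⟩
    -- The generators of `C` and their lifts to `B` lie in the same degree `d` as the generators of
    -- `A`, which keeps the combined cover linear.
    have hgen : ∀ j : κ, ∃ y ∈ ℬ d, g y = ρ (Pi.single j 1) := fun j => H.lift d _ <| by
      rw [h𝒞]
      exact ⟨_, single_mem_freePiece d j, rfl⟩
    choose y hy hgy using hgen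
    let lift : (κ → R) →ₗ[R] B := Fintype.linearCombination R y
    have glift : ∀ v, g (lift v) = ρ v := by
      intro v
      have h : g ∘ₗ lift = ρ := by
        refine LinearMap.pi_ext' fun j => LinearMap.ext_ring ?_
        simp [lift, hgy]
      exact LinearMap.congr_fun h v
    have lift_mem : ∀ e, ∀ v ∈ freePiece 𝒢 κ d e, lift v ∈ ℬ e := by
      intro e v hv
      rw [mem_freePiece] at hv
      rw [Fintype.linearCombination_apply]
      refine sum_mem fun j _ => ?_
      have h := hv j
      rw [twist] at h
      split_ifs at h with hde
      · have := hℬ _ _ _ _ h (hy j)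
        rwa [Nat.sub_add_cancel hde] at this
      · rw [AddSubgroup.mem_bot.mp h, zero_smul]
        exact zero_mem _
    let θ : (ι ⊕ κ → R) →ₗ[R] B :=
      f ∘ₗ π ∘ₗ LinearMap.funLeft R R Sum.inl + lift ∘ₗ LinearMap.funLeft R R Sum.inr
    have θapp : ∀ w, θ w = f (π (w ∘ Sum.inl)) + lift (w ∘ Sum.inr) := fun w => rfl
    have θelim : ∀ u v, θ (Sum.elim u v) = f (π u) + lift v := fun u v => by
      rw [θapp, Sum.elim_comp_inl, Sum.elim_comp_inr]
    have gθ : ∀ w, g (θ w) = ρ (w ∘ Sum.inr) := fun w => by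
      rw [θapp, map_add, glift, H.exact.apply_apply_eq_zero, zero_add]
    have memS : ∀ {e w}, w ∈ freePiece 𝒢 (ι ⊕ κ) d e ↔
        w ∘ Sum.inl ∈ freePiece 𝒢 ι d e ∧ w ∘ Sum.inr ∈ freePiece 𝒢 κ d e := by
      intro e w
      simp [mem_freePiece]
    have mem𝒜 : ∀ {e u}, u ∈ freePiece 𝒢 ι d e → π u ∈ 𝒜 e := fun {e u} hu => by
      rw [h𝒜]; exact ⟨u, hu, rfl⟩
    have lift𝒜 : ∀ {e x}, x ∈ 𝒜 e → ∃ u ∈ freePiece 𝒢 ι d e, π u = x := fun {e x} hx => by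
      rw [h𝒜] at hx; exact hx
    have lift𝒞 : ∀ {e x}, x ∈ 𝒞 e → ∃ u ∈ freePiece 𝒢 κ d e, ρ u = x := fun {e x} hx => by
      rw [h𝒞] at hx; exact hx
    refine ⟨ι ⊕ κ, inferInstance, θ, ?_, ?_, ?_⟩
    · intro z
      obtain ⟨v, hv⟩ := hρ (g z)
      obtain ⟨x, hx⟩ := (H.exact (z - lift v)).mp (by rw [map_sub, glift, hv, sub_self])
      obtain ⟨u, rfl⟩ := hπ x
      exact ⟨Sum.elim u v, by rw [θelim, hx, sub_add_cancel]⟩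
    · intro e
      ext z
      constructor
      · intro hz
        obtain ⟨v, hv, hvz⟩ := lift𝒞 (H.map_mem e z hz)
        obtain ⟨x, hx⟩ := (H.exact (z - lift v)).mp (by rw [map_sub, glift, hvz, sub_self])
        obtain ⟨u, hu, rfl⟩ := lift𝒜 ((H.mem_iff e x).mpr
          (hx ▸ sub_mem hz (lift_mem e v hv)))
        refine ⟨Sum.elim u v, memS.mpr ⟨by rwa [Sum.elim_comp_inl], by rwa [Sum.elim_comp_inr]⟩, ?_⟩
        change θ _ = _
        rw [θelim, hx, sub_add_cancel]
      · rintro ⟨w, hw, rfl⟩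
        have := memS.mp hw
        exact add_mem ((H.mem_iff e _).mp (mem𝒜 this.1)) (lift_mem e _ this.2)
    · let f' : LinearMap.ker π →ₗ[R] LinearMap.ker θ :=
        { toFun := fun u => ⟨Sum.elim u.1 0, by
            rw [LinearMap.mem_ker, θelim, LinearMap.mem_ker.mp u.2]
            simp⟩
          map_add' := fun u v => by ext (i | i) <;> simp
          map_smul' := fun r v => by ext (i | i) <;> simp }
      let g' : LinearMap.ker θ →ₗ[R] LinearMap.ker ρ :=
        { toFun := fun w => ⟨w.1 ∘ Sum.inr, by
            rw [LinearMap.mem_ker, ← gθ, LinearMap.mem_ker.mp w.2, map_zero]⟩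
          map_add' := fun u v => rfl
          map_smul' := fun r v => rfl }
      -- The kernels of the three covers again form a graded short exact sequence. Surjectivity onto
      -- `ker ρ` corrects a lift `v` by some `u` with `f (π u) = -lift v`.
      refine ih (d + 1) (f := f') (g := g') ⟨?_, ?_, ?_, ?_, ?_, ?_⟩
        ((gradedAction_freePiece _ _).comap _) hA hC
      · intro u v huv
        ext i
        exact congr_fun (congr_arg Subtype.val huv) (Sum.inl i)
      · rintro ⟨v, hv⟩
        obtain ⟨x, hx⟩ := (H.exact (lift v)).mp (by rw [glift]; exact hv)
        obtain ⟨u, hu⟩ := hπ (-x)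
        refine ⟨⟨Sum.elim u v, ?_⟩, Subtype.ext (Sum.elim_comp_inr u v)⟩
        rw [LinearMap.mem_ker, θelim, hu, map_neg, hx, neg_add_cancel]
      · rintro ⟨w, hw⟩
        constructor
        · intro h0
          have h0' : w ∘ Sum.inr = 0 := congr_arg Subtype.val h0
          rw [LinearMap.mem_ker, θapp, h0', map_zero, add_zero] at hw
          refine ⟨⟨w ∘ Sum.inl, H.inj (by rw [hw, map_zero])⟩, Subtype.ext ?_⟩
          funext i
          rcases i with i | i
          · rfl
          · exact (congr_fun h0' i).symm
        · rintro ⟨u, hu⟩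
          rw [← hu]
          rfl
      · intro e u
        refine ⟨fun h => memS.mpr ⟨h, zero_mem _⟩, fun h => (memS.mp h).1⟩
      · intro e w hw
        exact (memS.mp hw).2
      · rintro e ⟨v, hv⟩ hvm
        have hvm' : v ∈ freePiece 𝒢 κ d e := hvm
        obtain ⟨x, hx⟩ := (H.exact (lift v)).mp (by rw [glift]; exact hv)
        obtain ⟨u, hum, hu⟩ := lift𝒜 (neg_mem ((H.mem_iff e x).mpr (hx ▸ lift_mem e v hvm')))
        refine ⟨⟨Sum.elim u v, ?_⟩, memS.mpr ⟨?_, ?_⟩, Subtype.ext (Sum.elim_comp_inr u v)⟩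
        · rw [LinearMap.mem_ker, θelim, hu, map_neg, hx, neg_add_cancel]
        · exact hum
        · exact hvm'

/-- The cokernel of an injection from a module resolved in degree `d + 1` to one resolved in
degree `d` is resolved in degree `d`. -/
theorem LinearlyResolved.cokernel [SetLike.GradedMonoid 𝒢] {b d : ℕ} {𝒜 : ℕ → AddSubgroup A}
    {ℬ : ℕ → AddSubgroup B} {𝒞 : ℕ → AddSubgroup C} {f : A →ₗ[R] B} {g : B →ₗ[R] C}
    (H : GradedShortExact 𝒜 ℬ 𝒞 f g) (hA : LinearlyResolved 𝒢 b (d + 1) A 𝒜)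
    (hB : LinearlyResolved 𝒢 (b + 1) d B ℬ) : LinearlyResolved 𝒢 (b + 1) d C 𝒞 := by
  obtain ⟨ι, _, π, hπ, hℬ, hK⟩ := hB
  have memℬ : ∀ {e u}, u ∈ freePiece 𝒢 ι d e → π u ∈ ℬ e := fun {e u} hu => by
    rw [hℬ]; exact ⟨u, hu, rfl⟩
  have liftℬ : ∀ {e x}, x ∈ ℬ e → ∃ u ∈ freePiece 𝒢 ι d e, π u = x := fun {e x} hx => by
    rw [hℬ] at hx; exact hx
  let f' : LinearMap.ker π →ₗ[R] LinearMap.ker (g ∘ₗ π) :=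
    Submodule.inclusion (LinearMap.ker_le_ker_comp π g)
  -- The cover of `B` also covers `C`, and its new kernel is an extension of `A` by `ker π`. Both
  -- are resolved in degree `d + 1`, so the horseshoe lemma applies.
  let g' : LinearMap.ker (g ∘ₗ π) →ₗ[R] A := (LinearEquiv.ofInjective f H.inj).symm.toLinearMap ∘ₗ
    LinearMap.codRestrict (LinearMap.range f) (π ∘ₗ (LinearMap.ker (g ∘ₗ π)).subtype)
      (fun v => (H.exact _).mp v.2)
  have fg' : ∀ v, f (g' v) = π v.1 := fun v => by
    have := LinearEquiv.apply_symm_apply (LinearEquiv.ofInjective f H.inj)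
      (LinearMap.codRestrict (LinearMap.range f) (π ∘ₗ (LinearMap.ker (g ∘ₗ π)).subtype)
        (fun v => (H.exact _).mp v.2) v)
    exact congr_arg Subtype.val this
  have lift_ker : ∀ x u, π u = f x → ∃ h : u ∈ LinearMap.ker (g ∘ₗ π), g' ⟨u, h⟩ = x :=
    fun x u hu => ⟨(H.exact _).mpr ⟨x, hu.symm⟩, H.inj ((fg' _).trans hu)⟩
  refine ⟨ι, inferInstance, g ∘ₗ π, H.surj.comp hπ, ?_, ?_⟩
  · intro e
    ext z
    constructor
    · intro hz
      obtain ⟨y, hy, rfl⟩ := H.lift e z hz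
      obtain ⟨u, hu, rfl⟩ := liftℬ hy
      exact ⟨u, hu, rfl⟩
    · rintro ⟨u, hu, rfl⟩
      exact H.map_mem e _ (memℬ hu)
  · refine LinearlyResolved.extension b (d + 1) (f := f') (g := g') ⟨?_, ?_, ?_, ?_, ?_, ?_⟩
      ((gradedAction_freePiece ι d).comap _) hK hA
    · exact Submodule.inclusion_injective _
    · intro x
      obtain ⟨u, hu⟩ := hπ (f x)
      obtain ⟨h, hx⟩ := lift_ker x u hu
      exact ⟨_, hx⟩
    · intro v
      rw [← map_eq_zero_iff f H.inj, fg']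
      constructor
      · intro h
        exact ⟨⟨v.1, h⟩, rfl⟩
      · rintro ⟨u, rfl⟩
        exact u.2
    · intro e u
      rfl
    · intro e v hv
      rw [H.mem_iff, fg']
      exact memℬ hv
    · intro e x hx
      obtain ⟨u, hu, hux⟩ := liftℬ ((H.mem_iff e x).mp hx)
      obtain ⟨h, hx⟩ := lift_ker x u hux
      exact ⟨_, hu, hx⟩

/-- The graded pieces of `M(-1)`. -/
def shiftPiece {M : Type*} [AddCommGroup M] (𝒜 : ℕ → AddSubgroup M) : ℕ → AddSubgroup M
  | 0 => ⊥
  | e + 1 => 𝒜 e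

theorem LinearlyResolved.shift (b : ℕ) : ∀ (d : ℕ) (M : Type u) [AddCommGroup M] [Module R M]
    (𝒜 : ℕ → AddSubgroup M), LinearlyResolved 𝒢 b d M 𝒜 →
      LinearlyResolved 𝒢 b (d + 1) M (shiftPiece 𝒜) := by
  induction b with
  | zero => exact fun _ _ _ _ _ h => h
  | succ b ih =>
    rintro d M _ _ 𝒜 ⟨ι, _, π, hπ, h𝒜, hK⟩
    refine ⟨ι, inferInstance, π, hπ, ?_, ?_⟩
    · rintro (_ | e)
      · rw [freePiece_succ_zero, AddSubgroup.map_bot]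
        rfl
      · rw [freePiece_succ_succ]
        exact h𝒜 e
    · have h := ih _ _ _ hK
      refine (congr_arg (LinearlyResolved 𝒢 b (d + 1 + 1) (LinearMap.ker π)) ?_).mp h
      funext e
      rcases e with _ | e
      · ext v
        rw [freePiece_succ_zero]
        exact (Submodule.coe_eq_zero (x := v)).symm
      · rw [freePiece_succ_succ]
        rfl

/-- An isomorphism is an extension by the zero module. -/
theorem LinearlyResolved.of_equiv [SetLike.GradedMonoid 𝒢] {b d : ℕ} {𝒜 : ℕ → AddSubgroup A}
    {ℬ : ℕ → AddSubgroup B} (f : A ≃ₗ[R] B) (hf : ∀ e x, x ∈ 𝒜 e ↔ f x ∈ ℬ e)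
    (hℬ : GradedAction 𝒢 ℬ) (hA : LinearlyResolved 𝒢 b d A 𝒜) : LinearlyResolved 𝒢 b d B ℬ :=
  LinearlyResolved.extension b d (C := PUnit.{u + 1}) (𝒞 := fun _ => ⊥) (f := f.toLinearMap)
    (g := 0)
    { inj := f.injective
      surj := fun _ => ⟨0, Subsingleton.elim _ _⟩
      exact := fun y => ⟨fun _ => f.surjective y, fun _ => rfl⟩
      mem_iff := hf
      map_mem := fun _ _ _ => zero_mem _
      lift := fun _ _ _ => ⟨0, zero_mem _, Subsingleton.elim _ _⟩ }
    hℬ hA (of_subsingleton _ _ _ _)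

theorem linearlyResolved_of_equiv_ring (f : R ≃ₗ[R] A) {𝒜 : ℕ → AddSubgroup A}
    (h𝒜 : ∀ e, 𝒜 e = (𝒢 e).map f.toLinearMap.toAddMonoidHom) : LinearlyResolved 𝒢 1 0 A 𝒜 := by
  refine ⟨Unit, inferInstance, f.toLinearMap ∘ₗ LinearMap.proj (), ?_, ?_, ?_⟩
  · exact f.surjective.comp (LinearMap.proj_surjective ())
  · intro e
    rw [h𝒜]
    ext z
    constructor
    · rintro ⟨r, hr, rfl⟩
      exact ⟨fun _ => r, mem_freePiece.mpr fun _ => by simpa [twist] using hr, rfl⟩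
    · rintro ⟨v, hv, rfl⟩
      exact ⟨v (), by simpa [twist] using mem_freePiece.mp hv (), rfl⟩
  · refine subsingleton_of_forall_eq 0 fun v => Subtype.ext ?_
    funext i
    exact f.injective (v.2.trans (map_zero f).symm)

end Resolutions

/-! ### The short exact sequence of multiplication by a linear form -/

section ImageModules

open DirectSum

variable {R : Type u} [CommRing R] (𝒢 : ℕ → AddSubgroup R)

/-- The image of the ideal `I` in `R ⧸ p`. -/
abbrev imageModule (I p : Ideal R) : Submodule R (R ⧸ p) := Submodule.map (Submodule.mkQ p) I

/-- The graded pieces of the image of `I` in `R ⧸ p`. -/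
noncomputable def imagePiece (I p : Ideal R) (e : ℕ) : AddSubgroup (imageModule I p) :=
  ((𝒢 e).map (Submodule.mkQ p).toAddMonoidHom).comap (imageModule I p).subtype.toAddMonoidHom

variable {𝒢}

theorem mkQ_eq_iff {p : Ideal R} {x y : R} :
    Submodule.mkQ p x = Submodule.mkQ p y ↔ x - y ∈ p :=
  Submodule.Quotient.eq p

variable [GradedRing 𝒢]

theorem gradedAction_imagePiece (I p : Ideal R) : GradedAction 𝒢 (imagePiece 𝒢 I p) := by
  rintro i e r m hr ⟨x, hx, hxm⟩
  refine ⟨r * x, SetLike.mul_mem_graded hr hx, ?_⟩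
  have : Submodule.mkQ p (r * x) = r • Submodule.mkQ p x := map_smul _ r x
  exact this.trans (congr_arg (r • ·) hxm)

/-- If `I = I₁ + x I₀` modulo `p`, and `x` behaves like a nonzerodivisor whose colon ideals are the
expected ones, then multiplication by `x` and reduction modulo `x` form a short exact sequence. -/
theorem exists_gradedShortExact {I I₀ I₁ p : Ideal R} {x : R} (hx : x ∈ 𝒢 1)
    (hp : p.IsHomogeneous 𝒢) (hI₁ : I₁.IsHomogeneous 𝒢) (hI : I = I₁ ⊔ Ideal.span {x} * I₀)
    (hreg : ∀ h, x * h ∈ p → h ∈ p) (hcolon : ∀ h, x * h ∈ I ⊔ p → h ∈ I₀ ⊔ p) :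
    ∃ (f : imageModule I₀ p →ₗ[R] imageModule I p)
      (g : imageModule I p →ₗ[R] imageModule I₁ (p ⊔ Ideal.span {x})),
      GradedShortExact (shiftPiece (imagePiece 𝒢 I₀ p)) (imagePiece 𝒢 I p)
        (imagePiece 𝒢 I₁ (p ⊔ Ideal.span {x})) f g := by
  set q := p ⊔ Ideal.span {x} with hq
  have hpq : p ≤ q := le_sup_left
  have hxq : x ∈ q := Ideal.mem_sup_right (Ideal.mem_span_singleton_self x)
  have hqhom : q.IsHomogeneous 𝒢 := hp.sup (Ideal.homogeneous_span 𝒢 _ (by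
    rintro _ rfl; exact ⟨1, hx⟩))
  have hI₁I : I₁ ≤ I := hI ▸ le_sup_left
  have hfmem : ∀ y ∈ imageModule I₀ p, LinearMap.lsmul R (R ⧸ p) x y ∈ imageModule I p := by
    rintro _ ⟨h, hh, rfl⟩
    refine ⟨x * h, ?_, rfl⟩
    rw [hI]
    exact Ideal.mem_sup_right (Ideal.mul_mem_mul (Ideal.mem_span_singleton_self x) hh)
  have hgmem : ∀ y ∈ imageModule I p, Submodule.factor hpq y ∈ imageModule I₁ q := by
    rintro _ ⟨h, hh, rfl⟩
    rw [hI] at hh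
    obtain ⟨u, hu, v, hv, rfl⟩ := Submodule.mem_sup.mp hh
    refine ⟨u, hu, ?_⟩
    change Submodule.mkQ q u = Submodule.mkQ q (u + v)
    rw [mkQ_eq_iff, sub_add_cancel_left]
    obtain ⟨c, -, rfl⟩ := Ideal.mem_span_singleton_mul.mp hv
    exact q.neg_mem (q.mul_mem_right _ hxq)
  let f := (LinearMap.lsmul R (R ⧸ p) x).restrict hfmem
  let g := (Submodule.factor hpq).restrict hgmem
  have hinj : Function.Injective f := by
    rw [injective_iff_map_eq_zero]
    rintro ⟨_, h, hh, rfl⟩ h0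
    have h2 : x * h ∈ p := (Submodule.Quotient.mk_eq_zero p).mp (congr_arg Subtype.val h0)
    exact Subtype.ext ((Submodule.Quotient.mk_eq_zero p).mpr (hreg h h2))
  refine ⟨f, g, hinj, ?_, ?_, ?_, ?_, ?_⟩
  · rintro ⟨_, h, hh, rfl⟩
    exact ⟨⟨Submodule.mkQ p h, h, hI₁I hh, rfl⟩, rfl⟩
  · rintro ⟨_, h, hh, rfl⟩
    constructor
    · intro h0
      obtain ⟨w, hw, z, hz, hwz⟩ := Submodule.mem_sup.mp
        ((Submodule.Quotient.mk_eq_zero q).mp (congr_arg Subtype.val h0))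
      obtain ⟨c, rfl⟩ := Ideal.mem_span_singleton.mp hz
      obtain ⟨c₀, hc₀, c₁, hc₁, rfl⟩ := Submodule.mem_sup.mp (hcolon c (by
        rw [← add_sub_cancel_left w (x * c), hwz]
        exact sub_mem (Ideal.mem_sup_left hh) (Ideal.mem_sup_right hw)))
      refine ⟨⟨Submodule.mkQ p c₀, c₀, hc₀, rfl⟩, Subtype.ext ?_⟩
      change Submodule.mkQ p (x * c₀) = Submodule.mkQ p h
      rw [mkQ_eq_iff]
      have : x * c₀ - h = -(w + x * c₁) := by
        rw [show h = w + x * (c₀ + c₁) from hwz.symm]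
        ring
      rw [this]
      exact p.neg_mem (p.add_mem hw (p.mul_mem_left x hc₁))
    · rintro ⟨⟨_, c, hc, rfl⟩, hfc⟩
      rw [← hfc]
      exact Subtype.ext ((Submodule.Quotient.mk_eq_zero q).mpr (q.mul_mem_right c hxq))
  · rintro (_ | e) ⟨_, h, hh, rfl⟩
    · constructor
      · intro h0
        rw [AddSubgroup.mem_bot.mp h0, map_zero]
        exact zero_mem _
      -- A multiple of `x` has no component of degree `0`. Homogeneity of `p` therefore puts `r`,
      -- and hence `x * h`, in `p`.
      · rintro ⟨r, hr, hrx⟩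
        have hrx' : r - x * h ∈ p := mkQ_eq_iff.mp hrx
        have h1 := hp 0 hrx'
        rw [decompose_sub, DirectSum.sub_apply, AddSubgroup.coe_sub, decompose_of_mem_same _ hr,
          coe_decompose_mul_of_left_mem_of_not_le 𝒢 hx (by norm_num), sub_zero] at h1
        have h2 : x * h ∈ p := by
          simpa using p.sub_mem h1 hrx'
        refine AddSubgroup.mem_bot.mpr (Subtype.ext ?_)
        exact (Submodule.Quotient.mk_eq_zero p).mpr (hreg h h2)
    · constructor
      · rintro ⟨r, hr, hrh⟩
        refine ⟨x * r, ?_, ?_⟩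
        · rw [add_comm]
          exact SetLike.mul_mem_graded hx hr
        · refine mkQ_eq_iff.mpr ?_
          change x * r - x * h ∈ p
          rw [← mul_sub]
          exact p.mul_mem_left x (mkQ_eq_iff.mp hrh)
      · rintro ⟨r, hr, hrx⟩
        have hrx' : r - x * h ∈ p := mkQ_eq_iff.mp hrx
        have h1 := hp (e + 1) hrx'
        rw [decompose_sub, DirectSum.sub_apply, AddSubgroup.coe_sub, decompose_of_mem_same _ hr,
          coe_decompose_mul_of_left_mem_of_le 𝒢 hx (Nat.le_add_left 1 e), Nat.add_sub_cancel] at h1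
        -- The degree `e` component of `h` represents the same class, since `x` times the difference
        -- lies in `p`.
        refine ⟨decompose 𝒢 h e, SetLike.coe_mem _, mkQ_eq_iff.mpr (hreg _ ?_)⟩
        have : x * (decompose 𝒢 h e - h) =
          (r - x * h) - (r - x * (decompose 𝒢 h e)) := by ring
        rw [this]
        exact p.sub_mem hrx' h1
  · rintro e ⟨_, h, hh, rfl⟩ ⟨r, hr, hrh⟩
    exact ⟨r, hr, mkQ_eq_iff.mpr (hpq (mkQ_eq_iff.mp hrh))⟩
  · rintro e ⟨_, h, hh, rfl⟩ ⟨r, hr, hrh⟩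
    have h1 := hqhom e (mkQ_eq_iff.mp hrh)
    rw [decompose_sub, DirectSum.sub_apply, AddSubgroup.coe_sub, decompose_of_mem_same _ hr] at h1
    refine ⟨⟨Submodule.mkQ p (decompose 𝒢 h e), _, hI₁I (hI₁ e hh), rfl⟩,
      ⟨_, SetLike.coe_mem _, rfl⟩, Subtype.ext ?_⟩
    change Submodule.mkQ q (decompose 𝒢 h e) = Submodule.mkQ q h
    rw [mkQ_eq_iff]
    have : (decompose 𝒢 h e : R) - h = (r - h) - (r - decompose 𝒢 h e) := by ring
    rw [this]
    exact q.sub_mem (mkQ_eq_iff.mp hrh) h1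

end ImageModules

/-! ### Resolving fold product ideals modulo linear forms -/

section PolynomialRing

open MvPolynomial

variable {K : Type u} [Field K] {k : ℕ}

variable (K k) in
/-- The standard grading of the polynomial ring, by additive subgroups. -/
noncomputable def standardGrading (e : ℕ) : AddSubgroup (MvPolynomial (Fin k) K) :=
  (homogeneousSubmodule (Fin k) K e).toAddSubgroup

noncomputable instance standardGrading.gradedRing : GradedRing (standardGrading K k) where
  one_mem := (MvPolynomial.gradedAlgebra (σ := Fin k) (R := K)).one_mem
  mul_mem := (MvPolynomial.gradedAlgebra (σ := Fin k) (R := K)).mul_mem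
  decompose' := (MvPolynomial.gradedAlgebra (σ := Fin k) (R := K)).decompose'
  left_inv := (MvPolynomial.gradedAlgebra (σ := Fin k) (R := K)).left_inv
  right_inv := (MvPolynomial.gradedAlgebra (σ := Fin k) (R := K)).right_inv

theorem span_isHomogeneous {W : Submodule K (MvPolynomial (Fin k) K)}
    (hW : W ≤ homogeneousSubmodule (Fin k) K 1) :
    (Ideal.span (W : Set (MvPolynomial (Fin k) K))).IsHomogeneous (standardGrading K k) :=
  Ideal.homogeneous_span _ _ fun _ hx => ⟨1, hW hx⟩

theorem productIdeal_isHomogeneous {ι : Type*} {l : ι → MvPolynomial (Fin k) K}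
    (hl : ∀ i, l i ∈ homogeneousSubmodule (Fin k) K 1) (a : ℕ) (s : Finset ι) :
    (productIdeal l a s).IsHomogeneous (standardGrading K k) := by
  refine Ideal.homogeneous_span _ _ ?_
  rintro _ ⟨S, -, rfl⟩
  exact ⟨_, MvPolynomial.IsHomogeneous.prod S l (fun _ => 1) fun i _ => hl i⟩

theorem mem_span_of_linear_mul_mem {W : Submodule K (MvPolynomial (Fin k) K)}
    (hW : W ≤ homogeneousSubmodule (Fin k) K 1) {x h : MvPolynomial (Fin k) K}
    (hx : x ∈ homogeneousSubmodule (Fin k) K 1) (hxW : x ∉ W)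
    (hxh : x * h ∈ Ideal.span (W : Set (MvPolynomial (Fin k) K))) :
    h ∈ Ideal.span (W : Set (MvPolynomial (Fin k) K)) :=
  ((span_isPrime hW).mem_or_mem hxh).resolve_left fun hxp => hxW (mem_of_mem_span hW hx hxp)

/-- The Koszul resolution of the quotient by an ideal generated by linear forms. -/
theorem linearlyResolved_quotient_finset (t : Finset (MvPolynomial (Fin k) K))
    (ht : ∀ x ∈ t, x ∈ homogeneousSubmodule (Fin k) K 1) :
    ∃ b, LinearlyResolved (standardGrading K k) b 0
      (imageModule ⊤ (Ideal.span (Submodule.span K (t : Set (MvPolynomial (Fin k) K)) :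
        Set (MvPolynomial (Fin k) K))))
      (imagePiece (standardGrading K k) ⊤ _) := by
  classical
  induction t using Finset.induction_on with
  | empty =>
    refine ⟨1, ?_⟩
    have hp : Ideal.span (Submodule.span K ((∅ : Finset (MvPolynomial (Fin k) K)) :
        Set (MvPolynomial (Fin k) K)) : Set (MvPolynomial (Fin k) K)) = ⊥ := by simp
    rw [hp]
    let f : MvPolynomial (Fin k) K →ₗ[MvPolynomial (Fin k) K] imageModule ⊤ (⊥ : Ideal _) :=
      LinearMap.codRestrict _ (Submodule.mkQ ⊥) fun r => ⟨r, trivial, rfl⟩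
    have hf : Function.Bijective f := by
      refine ⟨fun r r' h => ?_, ?_⟩
      · exact LinearMap.ker_eq_bot.mp (Submodule.ker_mkQ _) (congr_arg Subtype.val h)
      · rintro ⟨_, r, hr, rfl⟩
        exact ⟨r, rfl⟩
    refine linearlyResolved_of_equiv_ring (LinearEquiv.ofBijective f hf) fun e => ?_
    ext y
    constructor
    · rintro ⟨r, hr, hry⟩
      exact ⟨r, hr, Subtype.ext hry⟩
    · rintro ⟨r, hr, rfl⟩
      exact ⟨r, hr, rfl⟩
  | insert x t hxt ih =>
    have hW : Submodule.span K (t : Set (MvPolynomial (Fin k) K)) ≤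
        homogeneousSubmodule (Fin k) K 1 :=
      Submodule.span_le.mpr fun y hy => ht y (Finset.mem_insert_of_mem hy)
    have hx := ht x (Finset.mem_insert_self x t)
    obtain ⟨b, hb⟩ := ih fun y hy => ht y (Finset.mem_insert_of_mem hy)
    have hspan : Submodule.span K ((insert x t : Finset (MvPolynomial (Fin k) K)) :
        Set (MvPolynomial (Fin k) K)) = Submodule.span K (t : Set (MvPolynomial (Fin k) K)) ⊔
          Submodule.span K {x} := by
      rw [Finset.coe_insert, Submodule.span_insert, sup_comm]
    rw [hspan]
    by_cases hxW : x ∈ Submodule.span K (t : Set (MvPolynomial (Fin k) K))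
    · rw [sup_of_le_left ((Submodule.span_singleton_le_iff_mem _ _).mpr hxW)]
      exact ⟨b, hb⟩
    -- With all three ideals equal to `R`, this is `0 → (R/p)(-1) → R/p → R/(p + x) → 0`.
    · obtain ⟨f, g, H⟩ := exists_gradedShortExact (𝒢 := standardGrading K k) (I := ⊤) (I₀ := ⊤)
        (I₁ := ⊤) (x := x) hx (span_isHomogeneous hW) (Ideal.IsHomogeneous.top _) (by simp)
        (fun h hh => mem_span_of_linear_mul_mem hW hx hxW hh) (fun h _ => by simp)
      rw [span_sup_singleton]
      exact ⟨b + 1, LinearlyResolved.cokernel H hb.shift hb.succ⟩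

theorem linearlyResolved_quotient {W : Submodule K (MvPolynomial (Fin k) K)}
    (hW : W ≤ homogeneousSubmodule (Fin k) K 1) :
    ∃ b, LinearlyResolved (standardGrading K k) b 0
      (imageModule ⊤ (Ideal.span (W : Set (MvPolynomial (Fin k) K))))
      (imagePiece (standardGrading K k) ⊤ _) := by
  have hfin : FiniteDimensional K (homogeneousSubmodule (Fin k) K 1) := by
    rw [homogeneousSubmodule_one_eq_span_X]
    exact FiniteDimensional.span_of_finite K (Set.finite_range _)
  have hW' : FiniteDimensional K W := Submodule.finiteDimensional_of_le hW
  obtain ⟨t, rfl⟩ := (Submodule.fg_iff_finiteDimensional W).mpr hW'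
  exact linearlyResolved_quotient_finset t fun x hx => hW (Submodule.subset_span hx)

/-- The induction parallels `mem_productIdeal_sup`; both outer terms of the exact sequence are
generated in degree `a + 1`, the left one after the shift. -/
theorem linearlyResolved_productIdeal {ι : Type*} {l : ι → MvPolynomial (Fin k) K}
    (hl : ∀ i, l i ∈ homogeneousSubmodule (Fin k) K 1) (s : Finset ι) :
    ∀ (a : ℕ) (W : Submodule K (MvPolynomial (Fin k) K)), W ≤ homogeneousSubmodule (Fin k) K 1 →
      ∃ b, LinearlyResolved (standardGrading K k) b a
        (imageModule (productIdeal l a s) (Ideal.span (W : Set (MvPolynomial (Fin k) K))))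
        (imagePiece (standardGrading K k) _ _) := by
  classical
  induction s using Finset.induction_on with
  | empty =>
    intro a W hW
    rcases a with _ | a
    · rw [productIdeal_zero]
      exact linearlyResolved_quotient hW
    · rw [productIdeal_succ_empty]
      have : Subsingleton (imageModule ⊥ (Ideal.span (W : Set (MvPolynomial (Fin k) K)))) := by
        rw [imageModule, Submodule.map_bot]
        infer_instance
      exact ⟨0, LinearlyResolved.of_subsingleton _ _ _ _⟩
  | insert i s hi ih =>
    intro a W hW
    rcases a with _ | a
    · rw [productIdeal_zero]
      exact linearlyResolved_quotient hW
    by_cases hiW : l i ∈ W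
    · obtain ⟨b, hb⟩ := ih (a + 1) W hW
      have heq : imageModule (productIdeal l (a + 1) s) (Ideal.span (W : Set _)) =
          imageModule (productIdeal l (a + 1) (insert i s)) (Ideal.span (W : Set _)) := by
        rw [productIdeal_succ_insert l a hi]
        refine le_antisymm (Submodule.map_mono le_sup_left) ?_
        rw [imageModule, Submodule.map_sup]
        refine sup_le le_rfl ?_
        rintro _ ⟨y, hy, rfl⟩
        obtain ⟨c, -, rfl⟩ := Ideal.mem_span_singleton_mul.mp hy
        have h0 : Submodule.mkQ (Ideal.span (W : Set _)) (l i * c) = 0 :=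
          (Submodule.Quotient.mk_eq_zero _).mpr (Ideal.mul_mem_right c _ (Ideal.subset_span hiW))
        rw [h0]
        exact zero_mem _
      exact ⟨b, LinearlyResolved.of_equiv (LinearEquiv.ofEq _ _ heq) (fun e x => Iff.rfl)
        (gradedAction_imagePiece _ _) hb⟩
    · have hW' : W ⊔ Submodule.span K {l i} ≤ homogeneousSubmodule (Fin k) K 1 :=
        sup_le hW ((Submodule.span_singleton_le_iff_mem _ _).mpr (hl i))
      obtain ⟨b, hb⟩ := ih a W hW
      obtain ⟨c, hc⟩ := ih (a + 1) _ hW'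
      rw [span_sup_singleton] at hc
      obtain ⟨f, g, H⟩ := exists_gradedShortExact (𝒢 := standardGrading K k) (x := l i) (hl i)
        (span_isHomogeneous hW) (productIdeal_isHomogeneous hl (a + 1) s)
        (productIdeal_succ_insert l a hi)
        (fun h hh => mem_span_of_linear_mul_mem hW (hl i) hiW hh)
        (fun h hh => mem_productIdeal_sup_of_mul_mem hl hi hW hiW hh)
      exact ⟨max b c, LinearlyResolved.extension _ _ H (gradedAction_imagePiece _ _)
        (hb.shift.mono (le_max_left b c)) (hc.mono (le_max_right b c))⟩

end PolynomialRing

/-! ### From recursive resolutions to explicit complexes -/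

section Resolution

open MvPolynomial

variable {K : Type u} [Field K] {k : ℕ}

/-- A linear graded free resolution of a module with specified graded pieces. -/
structure ModuleResolution (d : ℕ) (M : Type u) [AddCommGroup M] [Module (MvPolynomial (Fin k) K) M]
    (𝒜 : ℕ → AddSubgroup M) where
  /-- the index of the last nonzero free module -/
  b : ℕ
  /-- the ranks of the free modules -/
  rank : ℕ → ℕ
  rank_pos : ∀ j, j ≤ b → 1 ≤ rank j
  rank_zero : ∀ j, b < j → rank j = 0
  /-- the augmentation -/
  aug : (Fin (rank 0) → MvPolynomial (Fin k) K) →ₗ[MvPolynomial (Fin k) K] M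
  /-- the differentials -/
  diff : ∀ j : ℕ, (Fin (rank (j + 1)) → MvPolynomial (Fin k) K) →ₗ[MvPolynomial (Fin k) K]
    (Fin (rank j) → MvPolynomial (Fin k) K)
  aug_graded : ∀ e v, v ∈ gradedPiece K k (rank 0) d e → aug v ∈ 𝒜 e
  diff_graded : ∀ j e v, v ∈ gradedPiece K k (rank (j + 1)) (d + (j + 1)) e →
    diff j v ∈ gradedPiece K k (rank j) (d + j) e
  surj : Function.Surjective aug
  exact_aug : Function.Exact (diff 0) aug
  exact_diff : ∀ j, Function.Exact (diff (j + 1)) (diff j)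

theorem mem_gradedPiece_iff {r d e : ℕ} {v : Fin r → MvPolynomial (Fin k) K} :
    v ∈ gradedPiece K k r d e ↔ v ∈ freePiece (standardGrading K k) (Fin r) d e := by
  rw [mem_freePiece, gradedPiece, Submodule.mem_pi]
  refine forall_congr' fun i => ?_
  rw [twist]
  split_ifs
  · exact ⟨fun h => h trivial, fun h _ => h⟩
  · exact ⟨fun h => h trivial, fun h _ => h⟩

/-- The recursion allows free modules of rank zero. Stopping at the first zero syzygy module makes
all ranks up to `b` positive. -/
theorem LinearlyResolved.subsingleton_or_resolution (b : ℕ) : ∀ (d : ℕ) (M : Type u)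
    [AddCommGroup M] [Module (MvPolynomial (Fin k) K) M] (𝒜 : ℕ → AddSubgroup M),
    LinearlyResolved (standardGrading K k) b d M 𝒜 →
      Subsingleton M ∨ Nonempty (ModuleResolution (K := K) (k := k) d M 𝒜) := by
  induction b with
  | zero => exact fun d M _ _ 𝒜 h => Or.inl h
  | succ b ih =>
    rintro d M _ _ 𝒜 ⟨ι, _, π, hπ, h𝒜, hK⟩
    rcases subsingleton_or_nontrivial M with hM | hM
    · exact Or.inl hM
    refine Or.inr ?_
    have hι : Nonempty ι := by
      by_contra hι
      rw [not_nonempty_iff] at hι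
      exact not_subsingleton M hπ.subsingleton
    let ε := Fintype.equivFin ι
    let σ := LinearEquiv.funCongrLeft (MvPolynomial (Fin k) K) (MvPolynomial (Fin k) K) ε
    have mem_σ : ∀ {e v}, σ v ∈ freePiece (standardGrading K k) ι d e ↔
        v ∈ gradedPiece K k (Fintype.card ι) d e := by
      intro e v
      rw [mem_gradedPiece_iff, mem_freePiece, mem_freePiece]
      exact ε.forall_congr_left.trans (by simp [σ, LinearEquiv.funCongrLeft_apply, LinearMap.funLeft])
    have hsurj : Function.Surjective (π ∘ₗ σ.toLinearMap) := hπ.comp σ.surjective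
    have haug : ∀ e v, v ∈ gradedPiece K k (Fintype.card ι) d e →
        (π ∘ₗ σ.toLinearMap) v ∈ 𝒜 e := fun e v hv => by
      rw [h𝒜]
      exact ⟨σ v, mem_σ.mpr hv, rfl⟩
    rcases ih _ _ _ hK with hsub | ⟨⟨F⟩⟩
    · have hker : LinearMap.ker π = ⊥ := Submodule.subsingleton_iff_eq_bot.mp hsub
      have hinj : Function.Injective (π ∘ₗ σ.toLinearMap) :=
        (LinearMap.ker_eq_bot.mp hker).comp σ.injective
      exact ⟨{
        b := 0
        rank := fun j => Nat.casesOn j (Fintype.card ι) fun _ => 0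
        rank_pos := by
          rintro j hj
          obtain rfl := Nat.le_zero.mp hj
          exact Fintype.card_pos
        rank_zero := by
          rintro (_ | j) hj
          · exact absurd hj (lt_irrefl 0)
          · rfl
        aug := π ∘ₗ σ.toLinearMap
        diff := fun j => 0
        aug_graded := haug
        diff_graded := fun j e v _ => zero_mem _
        surj := hsurj
        exact_aug := fun v => by
          rw [map_eq_zero_iff _ hinj]
          exact ⟨fun h => ⟨0, h.symm⟩, fun ⟨_, h⟩ => h.symm⟩
        exact_diff := fun j v => ⟨fun _ => ⟨0, funext fun i => i.elim0⟩, fun _ => rfl⟩ }⟩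
    · let δ := σ.symm.toLinearMap ∘ₗ (LinearMap.ker π).subtype ∘ₗ F.aug
      have σδ : ∀ v, σ (δ v) = F.aug v := fun v => σ.apply_symm_apply _
      exact ⟨{
        b := F.b + 1
        rank := fun j => Nat.casesOn j (Fintype.card ι) F.rank
        rank_pos := by
          rintro (_ | j) hj
          · exact Fintype.card_pos
          · exact F.rank_pos j (Nat.le_of_succ_le_succ hj)
        rank_zero := by
          rintro (_ | j) hj
          · exact absurd hj (Nat.not_lt_zero _)
          · exact F.rank_zero j (Nat.lt_of_succ_lt_succ hj)
        aug := π ∘ₗ σ.toLinearMap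
        diff := fun j => match j with
          | 0 => δ
          | j + 1 => F.diff j
        aug_graded := haug
        diff_graded := by
          rintro (_ | j) e v hv
          · refine mem_σ.mp ?_
            change σ (δ v) ∈ _
            rw [σδ]
            exact F.aug_graded e v hv
          · have := F.diff_graded j e v
            rw [add_right_comm d 1 j, add_right_comm d 1 (j + 1)] at this
            exact this hv
        surj := hsurj
        exact_aug := fun v => by
          constructor
          · intro h
            obtain ⟨u, hu⟩ := F.surj ⟨σ v, h⟩
            exact ⟨u, σ.injective ((σδ u).trans (congr_arg Subtype.val hu))⟩
          · rintro ⟨u, rfl⟩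
            change π (σ (δ u)) = 0
            rw [σδ]
            exact (F.aug u).2
        exact_diff := by
          rintro (_ | j)
          · intro v
            refine Iff.trans ?_ (F.exact_aug v)
            change δ v = 0 ↔ _
            rw [← map_eq_zero_iff σ σ.injective, σδ, Submodule.coe_eq_zero]
          · exact F.exact_diff j }⟩

theorem hasLinearResolution_of_linearlyResolved {I : Ideal (MvPolynomial (Fin k) K)} {b d : ℕ}
    (h : LinearlyResolved (standardGrading K k) b d (imageModule I ⊥)
      (imagePiece (standardGrading K k) I ⊥)) : HasLinearResolution I d := by
  have hinj : Function.Injective (Submodule.mkQ (⊥ : Ideal (MvPolynomial (Fin k) K))) :=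
    LinearMap.ker_eq_bot.mp (Submodule.ker_mkQ _)
  rcases h.subsingleton_or_resolution with hM | ⟨⟨F⟩⟩
  · left
    rw [eq_bot_iff]
    intro x hx
    have : (⟨Submodule.mkQ ⊥ x, x, hx, rfl⟩ : imageModule I ⊥) = 0 := Subsingleton.elim _ _
    exact hinj ((congr_arg Subtype.val this).trans (map_zero _).symm)
  · right
    let ψ := (Submodule.equivMapOfInjective (Submodule.mkQ ⊥) hinj I).symm
    have hψ : ∀ y : imageModule I ⊥,
        Submodule.mkQ ⊥ (ψ y : MvPolynomial (Fin k) K) = y.1 := fun y =>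
      congr_arg Subtype.val (LinearEquiv.apply_symm_apply
        (Submodule.equivMapOfInjective (Submodule.mkQ ⊥) hinj I) y)
    exact ⟨{
      b := F.b
      rank := F.rank
      rank_pos := F.rank_pos
      rank_zero := F.rank_zero
      aug := I.subtype ∘ₗ ψ.toLinearMap ∘ₗ F.aug
      diff := F.diff
      aug_graded := fun e v hv => by
        obtain ⟨r, hr, hrv⟩ := F.aug_graded e v hv
        have : (ψ (F.aug v) : MvPolynomial (Fin k) K) = r := hinj ((hψ _).trans hrv.symm)
        change (ψ (F.aug v) : MvPolynomial (Fin k) K) ∈ _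
        rw [this]
        exact hr
      diff_graded := F.diff_graded
      exact_ring := fun x => by
        rw [Submodule.mkQ_apply, Submodule.Quotient.mk_eq_zero]
        constructor
        · intro hx
          obtain ⟨v, hv⟩ := F.surj (ψ.symm ⟨x, hx⟩)
          refine ⟨v, ?_⟩
          change (ψ (F.aug v) : MvPolynomial (Fin k) K) = x
          rw [hv, ψ.apply_symm_apply]
        · rintro ⟨v, rfl⟩
          exact (ψ (F.aug v)).2
      exact_aug := fun v => by
        refine Iff.trans ?_ (F.exact_aug v)
        change (ψ (F.aug v) : MvPolynomial (Fin k) K) = 0 ↔ _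
        rw [Submodule.coe_eq_zero, map_eq_zero_iff ψ ψ.injective]
      exact_diff := F.exact_diff }⟩

end Resolution

/-! ### Passing to the primes generated by members of the family -/

section Assembly

open MvPolynomial

variable {K : Type*} [Field K] {k n : ℕ} {l : Fin n → MvPolynomial (Fin k) K}

theorem foldProductIdeal_eq (a : ℕ) : foldProductIdeal l a = productIdeal l a Finset.univ := by
  rw [foldProductIdeal, productIdeal]
  congr 1
  ext f
  simp [Finset.mem_powersetCard, eq_comm]

theorem nu_add_avoid (p : Ideal (MvPolynomial (Fin k) K)) :
    nu l p + avoid l p Finset.univ = n := by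
  classical
  have h : nu l p = (Finset.univ.filter fun i => l i ∈ p).card := by
    rw [nu, Set.ncard_eq_toFinset_card']
    congr 1
    ext i
    simp
  rw [h, avoid]
  convert Finset.card_filter_add_card_filter_not (s := Finset.univ) (fun i => l i ∈ p)
  simp

theorem exponent_eq (a : ℕ) (p : Ideal (MvPolynomial (Fin k) K)) :
    exponent l a p = a - avoid l p Finset.univ := by
  have := nu_add_avoid (l := l) p
  rw [exponent]
  omega

theorem span_span_eq (S : Set (Fin n)) :
    Ideal.span (Submodule.span K (l '' S) : Set (MvPolynomial (Fin k) K)) =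
      Ideal.span (l '' S) :=
  Submodule.span_span_of_tower K (MvPolynomial (Fin k) K) (l '' S)

theorem span_image_le (hl : ∀ i, (l i).IsHomogeneous 1) (S : Set (Fin n)) :
    Submodule.span K (l '' S) ≤ homogeneousSubmodule (Fin k) K 1 := by
  rw [Submodule.span_le]
  rintro _ ⟨i, -, rfl⟩
  exact hl i

theorem foldProductIdeal_eq_iInf (hl : ∀ i, (l i).IsHomogeneous 1) (a : ℕ) :
    foldProductIdeal l a = ⨅ p ∈ linearPrimes l, p ^ exponent l a p := by
  rw [foldProductIdeal_eq]
  apply le_antisymm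
  · refine le_iInf₂ fun p _ => ?_
    rw [exponent_eq]
    exact productIdeal_le_pow l p a _
  · intro f hf
    have h := mem_productIdeal_sup (l := l) hl Finset.univ a ⊥ bot_le f fun V _ hV => by
      refine Ideal.mem_sup_left ?_
      -- Replacing `V` by the span of the forms it contains shrinks the ideal and loses none of
      -- those forms. The exponent does not decrease, so the condition at this prime implies the one
      -- at `V`.
      set S : Set (Fin n) := {i | l i ∈ V} with hS
      have hle : Ideal.span (l '' S) ≤ Ideal.span (V : Set (MvPolynomial (Fin k) K)) :=
        Ideal.span_mono (by rintro _ ⟨i, hi, rfl⟩; exact hi)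
      have hp : Ideal.span (l '' S) ∈ linearPrimes l :=
        ⟨span_span_eq (l := l) S ▸ span_isPrime (span_image_le hl S), S, rfl⟩
      have h1 := (Submodule.mem_iInf _).mp ((Submodule.mem_iInf _).mp hf _) hp
      rw [exponent_eq] at h1
      refine Ideal.pow_right_mono hle _ (Ideal.pow_le_pow_right ?_ h1)
      exact Nat.sub_le_sub_left (avoid_le_avoid l fun i _ hiV =>
        Ideal.subset_span (Set.mem_image_of_mem l (mem_of_mem_span hV (hl i) hiV))) a
    simpa using h

end Assembly

end LinearForms

theorem theorem2p2 {K : Type*} [Field K] [CharZero K] (k n a : ℕ)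
    (l : Fin n → MvPolynomial (Fin k) K) (hl : ∀ i, (l i).IsHomogeneous 1)
    (ha : 1 ≤ a) (han : a ≤ n) :
    LinearForms.HasLinearResolution (LinearForms.foldProductIdeal l a) a ∧
    (LinearForms.linearPrimes l).Finite ∧
    (∀ p ∈ LinearForms.linearPrimes l, 0 < LinearForms.exponent l a p →
      (p ^ LinearForms.exponent l a p).IsPrimary ∧
      (p ^ LinearForms.exponent l a p).radical = p) ∧
    LinearForms.foldProductIdeal l a =
      ⨅ p ∈ LinearForms.linearPrimes l, p ^ LinearForms.exponent l a p := by
  refine ⟨?_, ?_, ?_, LinearForms.foldProductIdeal_eq_iInf hl a⟩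
  · obtain ⟨b, hb⟩ := LinearForms.linearlyResolved_productIdeal (l := l) hl Finset.univ a ⊥ bot_le
    have hbot : Ideal.span ((⊥ : Submodule K (MvPolynomial (Fin k) K)) :
      Set (MvPolynomial (Fin k) K)) = ⊥ := by simp
    rw [hbot] at hb
    rw [LinearForms.foldProductIdeal_eq]
    exact LinearForms.hasLinearResolution_of_linearlyResolved hb
  · refine (Set.finite_range fun S : Set (Fin n) => Ideal.span (l '' S)).subset ?_
    rintro p ⟨-, S, rfl⟩
    exact ⟨S, rfl⟩
  · rintro p ⟨hp, S, rfl⟩ he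
    refine ⟨?_, by rw [Ideal.radical_pow _ he.ne', hp.radical]⟩
    have := LinearForms.span_pow_isPrimary (LinearForms.span_image_le hl S) he
    rwa [LinearForms.span_span_eq] at this
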